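/- Let $d\ge 2$ be an integer and let $\beta_0,\beta_1$ be real numbers with $\beta_0+(d-1)\beta_1=1$ and $0\le\beta_1<\frac1d<\beta_0\le 1$; put $Q=1-\beta_0$ (the error rate). Let Alice and Bob share the state $$\rho_{AB}=(\beta_0-\beta_1)\,|\Phi_{00}\rangle\langle\Phi_{00}|+\frac{\beta_1}{d}\,\mathbb 1_{d^2},\qquad |\Phi_{00}\rangle=\frac1{\sqrt d}\sum_{x=0}^{d-1}|xx\rangle,$$ on $\mathbb C^d\otimes\mathbb C^d$, and let $|\psi_{ABE}\rangle$ be any purification of $\rho_{AB}$ with finite-dimensional system $E$, held by Eve. Alice measures her system in the computational basis with outcome $X$; the resulting classical-quantum state is $\rho_{XE}=\sum_x p_x|x\rangle\langle x|\otimes\rho_E^x$ with $p_x\rho_E^x=\mathrm{tr}_{AB}\big((|x\rangle\langle x|\otimes\mathbb 1\otimes\mathbb 1)|\psi_{ABE}\rangle\langle\psi_{ABE}|\big)$. Define the guessing probability and the conditional min-entropy by $$p_{\rm guess}(X|E)=\max_{\{M_x\}\ \text{POVM on }E}\ \sum_x p_x\,\mathrm{tr}(M_x\rho_E^x),\qquad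 H_{\min}(X|E)=\sup_{\sigma_E}\big[-\log_2\min\{\lambda:\lambda\,\mathbb 1_X\otimes\sigma_E\ge\rho_{XE}\}\big],$$ where $\sigma_E$ runs over the density operators on $E$. Let $|E_{xy}\rangle$ be the normalization of $(\langle x|\otimes\langle y|\otimes\mathbb 1)|\psi_{ABE}\rangle$ (and $0$ if that vector is $0$), and put $$\rho^{(=)}=\frac1d\sum_x|E_{xx}\rangle\langle E_{xx}|,\qquad |e_{xx}\rangle=(d\rho^{(=)})^{-1/2}|E_{xx}\rangle$$ (the inverse square root being taken on the support of $\rho^{(=)}$), and $$\eta_0=\frac1d\left[1-\frac{(d-2)Q}{d(Q-1)}+2(d-1)\sqrt{\frac{dQ-(d+1)Q^2}{(d-1)d^2(1-Q)^2}}\right].$$ Then: 1. The $|E_{xx}\rangle$ are pyramid states: $\langle E_{xx}|E_{xx}\rangle=1$ and $\langle E_{xx}|E_{zz}\rangle=1-\beta_1/\beta_0$ for $x\ne z$. The square-root measurement discriminates them optimally: $|\langle e_{xx}|E_{xx}\rangle|^2=\eta_0$ for every $x$, and $\eta_0$ is the maximum over all POVMs $\{M_x\}$ on $E$ of $\frac1d\sum_x\langle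 E_{xx}|M_x|E_{xx}\rangle$. 2. The maximum defining $p_{\rm guess}(X|E)$ exists, and $p_{\rm guess}(X|E)=p_{\rm guess}(d,Q)$, where $$p_{\rm guess}(d,Q)=Q+(1-Q)\,\eta_0=Q+\frac{1-Q}{d}\left[1-\frac{(d-2)Q}{d(Q-1)}+2(d-1)\sqrt{\frac{dQ-(d+1)Q^2}{(d-1)d^2(1-Q)^2}}\right].$$ This value is reached with the square-root measurement: the operators $M_x=|e_{xx}\rangle\langle e_{xx}|+\sum_{y\ne x}|E_{xy}\rangle\langle E_{xy}|$ are positive semidefinite with $\sum_xM_x\le\mathbb 1$, and $\sum_xp_x\,\mathrm{tr}(M_x\rho_E^x)=p_{\rm guess}(X|E)$. 3. The supremum defining $H_{\min}(X|E)$ is finite, and $H_{\min}(X|E)=-\log_2p_{\rm guess}(d,Q)$. 4. For $d=2$, $p_{\rm guess}(X|E)=\frac12\left(1+\sqrt{Q(2-3Q)}+Q\right)$. -/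

import Mathlib

open scoped Kronecker Matrix ComplexOrder

noncomputable section

namespace QKD

open Matrix

/-! ### The state shared by Alice and Bob, and its purifications -/

/-- The rank-one operator `|v⟩⟨v|`. -/
def proj {n : Type*} (v : n → ℂ) : Matrix n n ℂ := vecMulVec v (star v)

/-- The maximally entangled vector `|Φ₀₀⟩ = d^{-1/2} ∑ₓ |x⟩|x⟩` of `ℂ^d ⊗ ℂ^d`. -/
def maxEntangled (d : ℕ) : Fin d × Fin d → ℂ :=
  fun p => if p.1 = p.2 then ((1 / √(d : ℝ) : ℝ) : ℂ) else 0

/-- The symmetrized state `(β₀ - β₁) |Φ₀₀⟩⟨Φ₀₀| + (β₁ / d) 𝟙` of `ℂ^d ⊗ ℂ^d`. -/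
def rhoAB (d : ℕ) (β₀ β₁ : ℝ) : Matrix (Fin d × Fin d) (Fin d × Fin d) ℂ :=
  ((β₀ - β₁ : ℝ) : ℂ) • proj (maxEntangled d) + ((β₁ / d : ℝ) : ℂ) • 1

/-- The partial trace over the second factor. -/
def partialTraceRight {a e : Type*} [Fintype e] (ρ : Matrix (a × e) (a × e) ℂ) : Matrix a a ℂ :=
  fun i j => ∑ k, ρ (i, k) (j, k)

/-- The vector `ψ` purifies `ρ`: the reduced state of `|ψ⟩⟨ψ|` is `ρ`. -/
def IsPurification {a e : Type*} [Fintype e] (ψ : a × e → ℂ) (ρ : Matrix a a ℂ) : Prop :=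
  partialTraceRight (proj ψ) = ρ

/-! ### Classical-quantum states, guessing probability and min-entropy

A classical-quantum state `∑ₓ pₓ |x⟩⟨x| ⊗ ρ_E^x` is given by the family of its blocks
`ω x = pₓ ρ_E^x`. -/

section CQ

variable {X e : Type*} [Fintype X] [DecidableEq X] [Fintype e] [DecidableEq e]

/-- The operator `∑ₓ |x⟩⟨x| ⊗ ω x`. -/
def cqState (ω : X → Matrix e e ℂ) : Matrix (X × e) (X × e) ℂ :=
  ∑ x, Matrix.single x x (1 : ℂ) ⊗ₖ ω x

/-- A POVM with outcomes in `X`. -/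
def IsPOVM (M : X → Matrix e e ℂ) : Prop :=
  (∀ x, (M x).PosSemidef) ∧ ∑ x, M x = 1

/-- The probability `∑ₓ tr (Mₓ ω x) = ∑ₓ pₓ tr (Mₓ ρ_E^x)` of a correct guess with `M`. -/
def guessValue (M ω : X → Matrix e e ℂ) : ℝ :=
  (∑ x, (M x * ω x).trace).re

/-- The success probabilities of all the POVMs. -/
def guessValues (ω : X → Matrix e e ℂ) : Set ℝ :=
  {p | ∃ M : X → Matrix e e ℂ, IsPOVM M ∧ guessValue M ω = p}

/-- The optimal guessing probability `p_guess(X|E)`. -/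
def pGuess (ω : X → Matrix e e ℂ) : ℝ := sSup (guessValues ω)

/-- A density operator. -/
def IsDensity (σ : Matrix e e ℂ) : Prop := σ.PosSemidef ∧ σ.trace = 1

/-- The numbers `-log₂ (min {λ | λ · 𝟙 ⊗ σ ≥ ρ})`, for the density operators `σ` for which such
a `λ` exists (for the other ones the value is `-∞`, and does not matter in the supremum). -/
def minEntropyValues (ρ : Matrix (X × e) (X × e) ℂ) : Set ℝ :=
  {h | ∃ (σ : Matrix e e ℂ) (l : ℝ), IsDensity σ ∧
    IsLeast {t : ℝ | ((t : ℂ) • ((1 : Matrix X X ℂ) ⊗ₖ σ) - ρ).PosSemidef} l ∧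
    h = -Real.logb 2 l}

/-- The conditional min-entropy `H_min(X|E)`. -/
def minEntropy (ρ : Matrix (X × e) (X × e) ℂ) : ℝ := sSup (minEntropyValues ρ)

end CQ

/-! ### Eve's states after Alice's measurement in the computational basis -/

section Eve

variable {d : ℕ} {e : Type*} [Fintype e] [DecidableEq e]

/-- Eve's block `pₓ ρ_E^x = tr_{AB} ((|x⟩⟨x| ⊗ 𝟙 ⊗ 𝟙) |ψ⟩⟨ψ|)`. -/
def eveBlock (ψ : (Fin d × Fin d) × e → ℂ) (x : Fin d) : Matrix e e ℂ :=
  fun k l => ∑ y, proj ψ ((x, y), k) ((x, y), l)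

/-- The vector `v / ‖v‖` for the Euclidean norm (and `0` for `v = 0`). -/
def normalize (v : e → ℂ) : e → ℂ :=
  (((√(star v ⬝ᵥ v).re)⁻¹ : ℝ) : ℂ) • v

/-- Eve's normalized state `|E_xy⟩` given that the measurements of Alice and Bob in the
computational basis yield `x` and `y`; it is the normalization of `(⟨x| ⊗ ⟨y| ⊗ 𝟙) |ψ⟩`. -/
def ancilla (ψ : (Fin d × Fin d) × e → ℂ) (x y : Fin d) : e → ℂ :=
  normalize fun k => ψ ((x, y), k)

/-- The ensemble of the pyramid states `|E_xx⟩`, each with probability `1 / d`. -/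
def pyramid (ψ : (Fin d × Fin d) × e → ℂ) (x : Fin d) : Matrix e e ℂ :=
  (1 / d : ℂ) • proj (ancilla ψ x x)

/-- `A^{-1/2}` on the support of the positive semidefinite operator `A`, and `0` on its kernel. -/
def invSqrt (A : Matrix e e ℂ) : Matrix e e ℂ := cfc (fun t : ℝ => (√t)⁻¹) A

/-- The vectors `|e_xx⟩ = (d ρ⁼)^{-1/2} |E_xx⟩` of the square-root measurement for the pyramid
states, with `ρ⁼ = (1 / d) ∑ₓ |E_xx⟩⟨E_xx|`. -/
def srmVector (ψ : (Fin d × Fin d) × e → ℂ) (x : Fin d) : e → ℂ :=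
  invSqrt ((d : ℂ) • ∑ z, pyramid ψ z) *ᵥ ancilla ψ x x

/-- Eve's measurement operators for the guess `x`: the square-root measurement on the span of
the pyramid states, and the projections on the states `|E_xy⟩` with `y ≠ x`. -/
def srmElement (ψ : (Fin d × Fin d) × e → ℂ) (x : Fin d) : Matrix e e ℂ :=
  proj (srmVector ψ x) + ∑ y with y ≠ x, proj (ancilla ψ x y)

end Eve

/-- The bracket in the formula for the guessing probability. -/
def bracket (d : ℕ) (Q : ℝ) : ℝ :=
  1 - (d - 2) * Q / (d * (Q - 1)) +
    2 * (d - 1) * √((d * Q - (d + 1) * Q ^ 2) / ((d - 1) * d ^ 2 * (1 - Q) ^ 2))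

end QKD

end

set_option linter.unusedSectionVars false

/-! Purification makes `rhoAB` the Gram matrix (transposed) of Eve's unnormalized vectors `ψ_xy`.
Those with `x ≠ y` have weight `β₁/d` and are orthogonal to each other and to all `ψ_zz`, so Eve
identifies them perfectly, which contributes `(d-1)β₁ = Q`. The rest is the discrimination of the
pyramid states, the columns of a matrix `V`.

The Gram matrix `G = VᴴV` has eigenvalue `l = a + d(1-a)` on constant vectors and `a = β₁/β₀` on
their complement. The square-root measurement `W = (VVᴴ)^{-1/2} V` satisfies `WᴴV = G^{1/2}`, whose
diagonal is a constant `s` (`sqrtDiag`), so it succeeds with probability `s²`.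

Optimality is semidefinite duality: if `K ≥ ω x` for all `x`, every POVM scores at most `tr K`. With
`S = WVᴴ`, the square root of `VVᴴ`, Cauchy-Schwarz for `S` gives `s S ≥ |V_x⟩⟨V_x|`
(`posSemidef_sqrtDiag_smul_sub`), and `tr S = d s`, so `(s/d) S` attains `s²`. Adding the
off-diagonal projectors yields a `K` for Alice's dit. The same `K`, normalized, is the optimal `σ`
for the min-entropy. It remains to rewrite `s²` in terms of `Q`. -/

namespace QKD

open Matrix

/-! ### Positive semidefinite matrices and functional calculus. -/

section Semidefinite

variable {n m : Type*} [Fintype n] [Fintype m]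

lemma posSemidef_proj (v : n → ℂ) : (proj v).PosSemidef :=
  posSemidef_vecMulVec_self_star v

lemma posSemidef_real_smul {A : Matrix n n ℂ} (hA : A.PosSemidef) {t : ℝ} (ht : 0 ≤ t) :
    ((t : ℂ) • A).PosSemidef :=
  hA.smul (by exact_mod_cast ht)

lemma proj_smul (c : ℂ) (v : n → ℂ) : proj (c • v) = (c * star c) • proj v := by
  ext i j
  simp only [proj, vecMulVec_apply, Pi.smul_apply, Pi.star_apply, star_smul, Matrix.smul_apply,
    smul_eq_mul]
  ring

lemma trace_proj_mul_proj (u w : n → ℂ) :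
    (proj u * proj w).trace = Complex.normSq (star u ⬝ᵥ w) := by
  rw [proj, proj, vecMulVec_mul_vecMulVec, trace_vecMulVec, dotProduct_smul, smul_eq_mul,
    ← Complex.mul_conj]
  congr 1
  rw [starRingEnd_apply, star_dotProduct, dotProduct_comm]
  simp

lemma sum_proj_col (W : Matrix n m ℂ) : ∑ x, proj (W.col x) = W * Wᴴ := by
  ext i j
  simp [proj, vecMulVec_apply, Matrix.sum_apply, mul_apply]

/-- The trace of the product of two positive semidefinite matrices is nonnegative. -/
lemma re_trace_mul_nonneg {A B : Matrix n n ℂ} (hA : A.PosSemidef) (hB : B.PosSemidef) :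
    0 ≤ (A * B).trace.re := by
  classical
  obtain ⟨C, rfl⟩ : ∃ C : Matrix n n ℂ, A = Cᴴ * C := by
    open scoped MatrixOrder in
    exact CStarAlgebra.nonneg_iff_eq_star_mul_self.mp hA.nonneg
  rw [Matrix.mul_assoc, trace_mul_comm]
  exact (Complex.le_def.mp (hB.mul_mul_conjTranspose_same C).trace_nonneg).1

/-- The Cauchy-Schwarz inequality for the semi-inner product given by `T`. -/
lemma posSemidef_smul_sub_proj_mulVec [DecidableEq n] {T : Matrix n n ℂ} (hT : T.PosSemidef)
    (u : n → ℂ) {s : ℝ} (hs : 0 < s) (hu : star u ⬝ᵥ T *ᵥ u = s) :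
    ((s : ℂ) • T - proj (T *ᵥ u)).PosSemidef := by
  have hs' : (s : ℂ) ≠ 0 := by exact_mod_cast hs.ne'
  have hw : star (T *ᵥ u) = star u ᵥ* T := by rw [star_mulVec, hT.1.eq]
  -- Congruence of `T` by the `T`-orthogonal projection that kills `u`.
  have h := posSemidef_real_smul (hT.conjTranspose_mul_mul_same
    (1 - ((s : ℂ)⁻¹) • vecMulVec u (star (T *ᵥ u)))) hs.le
  convert h using 1
  have h1 : vecMulVec (T *ᵥ u) (star u) * T = proj (T *ᵥ u) := by
    rw [vecMulVec_mul, ← hw, proj]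
  have h2 : T * vecMulVec u (star (T *ᵥ u)) = proj (T *ᵥ u) := by
    rw [mul_vecMulVec, proj]
  have h3 : proj (T *ᵥ u) * vecMulVec u (star (T *ᵥ u)) = (s : ℂ) • proj (T *ᵥ u) := by
    rw [proj, vecMulVec_mul_vecMulVec, hw, ← dotProduct_mulVec, hu, vecMulVec_smul]
  rw [conjTranspose_sub, conjTranspose_one, conjTranspose_smul, conjTranspose_vecMulVec, star_star,
    Matrix.sub_mul, Matrix.one_mul, Matrix.smul_mul, h1]
  simp only [Matrix.sub_mul, Matrix.mul_sub, Matrix.mul_one, Matrix.smul_mul, Matrix.mul_smul, h2,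
    h3]
  have hst : star (s : ℂ)⁻¹ = (s : ℂ)⁻¹ := by simp
  simp only [hst, smul_sub, smul_smul, mul_inv_cancel₀ hs', inv_mul_cancel₀ hs', one_smul,
    sub_self, sub_zero]

/-- The continuous functional calculus on a family of eigenvectors. -/
lemma cfc_mul_of_mul_eq_smul [DecidableEq n] {A : Matrix n n ℂ} (hA : A.IsHermitian)
    {W : Matrix n m ℂ} {t : ℝ} (h : A * W = (t : ℂ) • W) (f : ℝ → ℝ) :
    cfc f A * W = (f t : ℂ) • W := by
  set U : Matrix n n ℂ := (hA.eigenvectorUnitary : Matrix n n ℂ) with hU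
  have hU1 : star U * U = 1 := Unitary.coe_star_mul_self hA.eigenvectorUnitary
  have hU2 : U * star U = 1 := Unitary.coe_mul_star_self hA.eigenvectorUnitary
  have hAe : A = U * diagonal (fun i => (hA.eigenvalues i : ℂ)) * star U := hA.spectral_theorem
  have hfe : cfc f A = U * diagonal (fun i => (f (hA.eigenvalues i) : ℂ)) * star U := by
    rw [hA.cfc_eq]; rfl
  have key : diagonal (fun i => (hA.eigenvalues i : ℂ)) * (star U * W) =
      (t : ℂ) • (star U * W) := by
    rw [← Matrix.mul_smul, ← h]
    conv_rhs => rw [hAe]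
    simp only [← Matrix.mul_assoc, hU1, Matrix.one_mul]
  have key' : diagonal (fun i => (f (hA.eigenvalues i) : ℂ)) * (star U * W) =
      (f t : ℂ) • (star U * W) := by
    ext i j
    have := congr_fun (congr_fun key i) j
    simp only [diagonal_mul, Matrix.smul_apply, smul_eq_mul] at this ⊢
    -- In the eigenbasis each entry of `star U * W` either vanishes or sits at an eigenvalue equal
    -- to `t`.
    rcases mul_eq_mul_right_iff.mp this with h' | h'
    · rw [Complex.ofReal_inj.mp h']
    · rw [h']; simp
  rw [hfe, Matrix.mul_assoc, Matrix.mul_assoc, key', Matrix.mul_smul, ← Matrix.mul_assoc, hU2,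
    Matrix.one_mul]

lemma posSemidef_one_sub_of_sq [DecidableEq n] {Z : Matrix n n ℂ} (hZ : Z.IsHermitian)
    (h : Z * Z = Z) : (1 - Z).PosSemidef := by
  have h1 : (1 - Z)ᴴ * (1 - Z) = 1 - Z := by
    rw [conjTranspose_sub, conjTranspose_one, hZ.eq, Matrix.sub_mul, Matrix.mul_sub Z, h]
    simp
  rw [← h1]
  exact posSemidef_conjTranspose_mul_self _

end Semidefinite

/-! ### Semidefinite duality for guessing probability and min-entropy. -/

section Duality

variable {X e : Type*} [Fintype X] [DecidableEq X] [Fintype e] [DecidableEq e]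
  {ω : X → Matrix e e ℂ} {K : Matrix e e ℂ}

lemma guessValue_eq_sum (M ω : X → Matrix e e ℂ) :
    guessValue M ω = ∑ x, (M x * ω x).trace.re := by
  simp [guessValue]

/-- Weak duality: completeness splits `tr K` as `∑ tr (Mₓ K)`, and each `tr (Mₓ (K - ω x))` is
nonnegative. -/
lemma guessValue_le_of_dual {M : X → Matrix e e ℂ} (hM : IsPOVM M)
    (hK : ∀ x, (K - ω x).PosSemidef) : guessValue M ω ≤ K.trace.re := by
  have h : K.trace.re = ∑ x, (M x * K).trace.re := by
    rw [← Complex.re_sum, ← trace_sum, ← Finset.sum_mul, hM.2, one_mul]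
  rw [guessValue_eq_sum, h]
  refine Finset.sum_le_sum fun x _ => ?_
  have := re_trace_mul_nonneg (hM.1 x) (hK x)
  rw [mul_sub, trace_sub, Complex.sub_re] at this
  linarith

/-- A measurement with an inconclusive outcome can be completed without loss. -/
lemma exists_isPOVM_guessValue_ge [Nonempty X] {M : X → Matrix e e ℂ}
    (hM : ∀ x, (M x).PosSemidef) (hM1 : (1 - ∑ x, M x).PosSemidef)
    (hω : ∀ x, (ω x).PosSemidef) : ∃ N, IsPOVM N ∧ guessValue M ω ≤ guessValue N ω := by
  obtain ⟨x₀⟩ := ‹Nonempty X›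
  -- The inconclusive outcome is read as the guess `x₀`; this cannot lower the score.
  refine ⟨fun x => M x + if x = x₀ then 1 - ∑ x, M x else 0, ⟨fun x => ?_, ?_⟩, ?_⟩
  · dsimp only
    split_ifs
    · exact (hM x).add hM1
    · simpa using hM x
  · simp [Finset.sum_add_distrib]
  · rw [guessValue_eq_sum, guessValue_eq_sum]
    refine Finset.sum_le_sum fun x _ => ?_
    rw [add_mul, trace_add, Complex.add_re]
    split_ifs
    · linarith [re_trace_mul_nonneg hM1 (hω x)]
    · simp

/-- Strong duality for the guessing probability from a pair of feasible points. -/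
lemma isGreatest_guessValues [Nonempty X] {M : X → Matrix e e ℂ}
    (hM : ∀ x, (M x).PosSemidef) (hM1 : (1 - ∑ x, M x).PosSemidef)
    (hω : ∀ x, (ω x).PosSemidef) (hK : ∀ x, (K - ω x).PosSemidef)
    (h : guessValue M ω = K.trace.re) : IsGreatest (guessValues ω) K.trace.re := by
  obtain ⟨N, hN, hle⟩ := exists_isPOVM_guessValue_ge hM hM1 hω
  refine ⟨⟨N, hN, (guessValue_le_of_dual hN hK).antisymm (h ▸ hle)⟩, ?_⟩
  rintro _ ⟨L, hL, rfl⟩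
  exact guessValue_le_of_dual hL hK

lemma smul_one_kronecker_sub_cqState (t : ℂ) (σ : Matrix e e ℂ) :
    t • ((1 : Matrix X X ℂ) ⊗ₖ σ) - cqState ω =
      ∑ x, Matrix.single x x (1 : ℂ) ⊗ₖ (t • σ - ω x) := by
  ext ⟨x, k⟩ ⟨y, l⟩
  simp [cqState, Matrix.sum_apply, kroneckerMap_apply, Matrix.one_apply, Matrix.single_apply,
    mul_sub, Finset.sum_sub_distrib]
  by_cases h : x = y
  · simp [h]
  · have : ∀ z, ¬ (z = x ∧ z = y) := fun z hz => h (hz.1.symm.trans hz.2)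
    simp [h, this]

/-- The operator is block diagonal, so the min-entropy constraint says that `t • σ` is a dual point
of the guessing problem. -/
lemma posSemidef_smul_one_kronecker_sub_cqState_iff (t : ℂ) (σ : Matrix e e ℂ) :
    (t • ((1 : Matrix X X ℂ) ⊗ₖ σ) - cqState ω).PosSemidef ↔
      ∀ x, (t • σ - ω x).PosSemidef := by
  rw [smul_one_kronecker_sub_cqState]
  refine ⟨fun h x => ?_, fun h => posSemidef_sum _ fun x _ => ?_⟩
  · convert h.submatrix (fun k : e => (x, k)) using 1
    ext k l
    simp [Matrix.sum_apply, Matrix.single_apply]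
  · refine PosSemidef.kronecker ?_ (h x)
    rw [← Matrix.diagonal_single]
    exact PosSemidef.diagonal (Pi.single_nonneg.mpr zero_le_one)

/-- The min-entropy is the negative logarithm of the guessing probability. -/
lemma isGreatest_minEntropyValues (hω : ∀ x, (ω x).PosSemidef) (hK : ∀ x, (K - ω x).PosSemidef)
    (hpos : 0 < K.trace.re) (hG : IsGreatest (guessValues ω) K.trace.re) :
    IsGreatest (minEntropyValues (cqState ω)) (-Real.logb 2 K.trace.re) := by
  obtain ⟨⟨M, hM, hMp⟩, -⟩ := hG
  have hlow : ∀ (σ : Matrix e e ℂ) (t : ℝ), IsDensity σ →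
      (∀ x, ((t : ℂ) • σ - ω x).PosSemidef) → K.trace.re ≤ t := by
    intro σ t hσ h
    have := guessValue_le_of_dual hM h
    rwa [hMp, trace_smul, hσ.2, smul_eq_mul, mul_one, Complex.ofReal_re] at this
  have hne : Nonempty X := by
    by_contra hX
    rw [not_nonempty_iff] at hX
    simp [guessValue] at hMp
    exact hpos.ne hMp
  obtain ⟨x₀⟩ := hne
  have hKpsd : K.PosSemidef := by simpa using (hK x₀).add (hω x₀)
  have htr : K.trace = (K.trace.re : ℂ) :=
    Complex.ext rfl (by simpa using (Complex.le_def.mp hKpsd.trace_nonneg).2.symm)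
  have hne : (K.trace.re : ℂ) ≠ 0 := by exact_mod_cast hpos.ne'
  -- The witness is `σ = K / tr K` with `λ = tr K`; `hlow` shows that no pair does better.
  refine ⟨⟨((K.trace.re⁻¹ : ℝ) : ℂ) • K, K.trace.re, ?_, ⟨?_, ?_⟩, rfl⟩, ?_⟩
  · refine ⟨posSemidef_real_smul hKpsd (inv_nonneg.mpr hpos.le), ?_⟩
    rw [trace_smul, smul_eq_mul, Complex.ofReal_inv]
    nth_rewrite 2 [htr]
    exact inv_mul_cancel₀ hne
  · rw [Set.mem_ofPred_eq, posSemidef_smul_one_kronecker_sub_cqState_iff, smul_smul,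
      Complex.ofReal_inv, mul_inv_cancel₀ hne, one_smul]
    exact hK
  · intro t ht
    rw [Set.mem_ofPred_eq, posSemidef_smul_one_kronecker_sub_cqState_iff] at ht
    refine hlow (((K.trace.re⁻¹ : ℝ) : ℂ) • K) t
      ⟨posSemidef_real_smul hKpsd (inv_nonneg.mpr hpos.le), ?_⟩ ht
    rw [trace_smul, smul_eq_mul, Complex.ofReal_inv]
    nth_rewrite 2 [htr]
    exact inv_mul_cancel₀ hne
  · rintro _ ⟨σ, l, hσ, hl, rfl⟩
    have hl1 := hl.1
    rw [Set.mem_ofPred_eq, posSemidef_smul_one_kronecker_sub_cqState_iff] at hl1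
    exact neg_le_neg (Real.logb_le_logb_of_le one_lt_two hpos (hlow σ l hσ hl1))

end Duality

/-! ### The algebra of permutation-invariant Gram matrices. -/

/-- The symmetric matrix with eigenvalue `q` on the constant vectors and `p` on their orthogonal
complement. -/
noncomputable def circ (d : ℕ) (p q : ℝ) : Matrix (Fin d) (Fin d) ℂ :=
  fun x z => (((if x = z then p else 0) + (q - p) / d : ℝ) : ℂ)

section Circ

variable {d : ℕ}

/-- `circ d p q` combines two complementary orthogonal projections, so products act on eigenvalues.
-/
lemma circ_mul (hd : d ≠ 0) (p q p' q' : ℝ) :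
    circ d p q * circ d p' q' = circ d (p * p') (q * q') := by
  have hd' : (d : ℝ) ≠ 0 := by exact_mod_cast hd
  ext x z
  simp only [circ, mul_apply]
  norm_cast
  simp only [add_mul, mul_add, Finset.sum_add_distrib, ite_mul, mul_ite, zero_mul, mul_zero,
    Finset.sum_ite_eq, Finset.sum_ite_eq', Finset.mem_univ, if_true, Finset.sum_const,
    Finset.card_univ, Fintype.card_fin, nsmul_eq_mul]
  split_ifs <;> field_simp <;> ring

lemma circ_conjTranspose (p q : ℝ) : (circ d p q)ᴴ = circ d p q := by
  ext x z
  simp only [circ, conjTranspose_apply, eq_comm (a := z), RCLike.star_def, Complex.conj_ofReal]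

lemma circ_one_one : circ d 1 1 = 1 := by
  ext x z
  simp only [circ, Matrix.one_apply]
  split_ifs <;> simp

lemma circ_smul (c p q : ℝ) : (c : ℂ) • circ d p q = circ d (c * p) (c * q) := by
  ext x z
  simp only [circ, Matrix.smul_apply, smul_eq_mul]
  norm_cast
  split_ifs <;> ring

lemma circ_add (p q p' q' : ℝ) : circ d p q + circ d p' q' = circ d (p + p') (q + q') := by
  ext x z
  simp only [circ, Matrix.add_apply]
  norm_cast
  split_ifs <;> ring

lemma circ_apply_self (x : Fin d) (p q : ℝ) :
    circ d p q x x = ((p + (q - p) / d : ℝ) : ℂ) := by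
  simp [circ]

lemma posSemidef_circ (hd : d ≠ 0) {p q : ℝ} (hp : 0 ≤ p) (hq : 0 ≤ q) :
    (circ d p q).PosSemidef := by
  have h := posSemidef_conjTranspose_mul_self (circ d (√p) (√q))
  rwa [circ_conjTranspose, circ_mul hd, Real.mul_self_sqrt hp, Real.mul_self_sqrt hq] at h

end Circ

/-! ### The square-root measurement for a symmetric family of vectors. -/

section SquareRoot

variable {d : ℕ} {e : Type*} [Fintype e] [DecidableEq e] {V : Matrix e (Fin d) ℂ} {a l : ℝ}

/-- If `a = 0`, then `V` kills the complement of the constants and `p` is immaterial. This covers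
the degenerate case `β₁ = 0`, where `(√a)⁻¹ = 0`. -/
lemma mul_circ_congr (hd : d ≠ 0) (hG : Vᴴ * V = circ d a l) {p p' q : ℝ}
    (h : a ≠ 0 → p = p') : V * circ d p q = V * circ d p' q := by
  by_cases ha : a = 0
  · have h0 : V * circ d 1 0 = 0 := by
      rw [← conjTranspose_mul_self_eq_zero, conjTranspose_mul, circ_conjTranspose,
        Matrix.mul_assoc, ← Matrix.mul_assoc Vᴴ, hG, circ_mul hd, circ_mul hd, ha]
      ext
      simp [circ]
    have h1 : circ d p q = circ d p' q + ((p - p' : ℝ) : ℂ) • circ d 1 0 := by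
      rw [circ_smul, circ_add]
      congr 1 <;> ring
    rw [h1, Matrix.mul_add, Matrix.mul_smul, h0, smul_zero, add_zero]
  · rw [h ha]

/-- The matrix whose columns are the vectors of the square-root measurement for the columns
of `V`. -/
noncomputable def srmMatrix (V : Matrix e (Fin d) ℂ) : Matrix e (Fin d) ℂ := invSqrt (V * Vᴴ) * V

/-- The identity `VVᴴ(VP) = V(GP)` makes the columns of `V * circ d 1 0` and `V * circ d 0 1`
eigenvectors (possibly zero) of `VVᴴ` for `a` and `l`, so the functional calculus acts on them by
scalars. -/
lemma srmMatrix_eq (hd : d ≠ 0) (hG : Vᴴ * V = circ d a l) :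
    srmMatrix V = V * circ d (√a)⁻¹ (√l)⁻¹ := by
  have hH : (V * Vᴴ).IsHermitian := isHermitian_mul_conjTranspose_self V
  have h1 : V * Vᴴ * (V * circ d 1 0) = (a : ℂ) • (V * circ d 1 0) := by
    rw [Matrix.mul_assoc, ← Matrix.mul_assoc Vᴴ, hG, circ_mul hd, ← Matrix.mul_smul, circ_smul,
      mul_zero, mul_zero]
  have h2 : V * Vᴴ * (V * circ d 0 1) = (l : ℂ) • (V * circ d 0 1) := by
    rw [Matrix.mul_assoc, ← Matrix.mul_assoc Vᴴ, hG, circ_mul hd, ← Matrix.mul_smul, circ_smul,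
      mul_zero, mul_zero]
  have hV : V = V * circ d 1 0 + V * circ d 0 1 := by
    rw [← Matrix.mul_add, circ_add, add_zero, zero_add, circ_one_one, Matrix.mul_one]
  have h3 : srmMatrix V = invSqrt (V * Vᴴ) * (V * circ d 1 0) +
      invSqrt (V * Vᴴ) * (V * circ d 0 1) := by
    rw [← Matrix.mul_add, ← hV, srmMatrix]
  rw [h3, invSqrt, cfc_mul_of_mul_eq_smul hH h1, cfc_mul_of_mul_eq_smul hH h2, ← Matrix.mul_smul,
    ← Matrix.mul_smul, ← Matrix.mul_add, circ_smul, circ_smul, circ_add]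
  simp

/-- No sign condition: for `a ≤ 0` both sides are `0`. -/
lemma inv_sqrt_mul_self (a : ℝ) : (√a)⁻¹ * a = √a := by
  rw [inv_mul_eq_div, Real.div_sqrt]

lemma conjTranspose_srmMatrix_mul (hd : d ≠ 0) (hG : Vᴴ * V = circ d a l) :
    (srmMatrix V)ᴴ * V = circ d (√a) (√l) := by
  rw [srmMatrix_eq hd hG, conjTranspose_mul, circ_conjTranspose, Matrix.mul_assoc, hG,
    circ_mul hd, inv_sqrt_mul_self, inv_sqrt_mul_self]

/-- `W` is a partial isometry, hence `WWᴴ`, the sum of the measurement operators, is a projection.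
-/
lemma srmMatrix_mul_sq (hd : d ≠ 0) (hG : Vᴴ * V = circ d a l) (ha : 0 ≤ a) (hl : 0 < l) :
    srmMatrix V * (srmMatrix V)ᴴ * srmMatrix V = srmMatrix V := by
  have h := conjTranspose_srmMatrix_mul hd hG
  rw [srmMatrix_eq hd hG] at h ⊢
  rw [Matrix.mul_assoc, ← Matrix.mul_assoc _ᴴ, h, circ_mul hd, Matrix.mul_assoc, circ_mul hd]
  have hl' : √l ≠ 0 := (Real.sqrt_pos.mpr hl).ne'
  rw [mul_inv_cancel₀ hl', mul_one]
  refine mul_circ_congr hd hG fun h0 => ?_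
  have ha' : √a ≠ 0 := (Real.sqrt_pos.mpr (lt_of_le_of_ne ha h0.symm)).ne'
  rw [mul_inv_cancel₀ ha', mul_one]

lemma srmMatrix_mul_mul_self (hd : d ≠ 0) (hG : Vᴴ * V = circ d a l) (ha : 0 ≤ a) (hl : 0 < l) :
    srmMatrix V * (srmMatrix V)ᴴ * (srmMatrix V * (srmMatrix V)ᴴ) =
      srmMatrix V * (srmMatrix V)ᴴ := by
  rw [← Matrix.mul_assoc, srmMatrix_mul_sq hd hG ha hl]

/-- The operator `srmMatrix V * Vᴴ`, which is the square root of `V * Vᴴ`, is positive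
semidefinite. -/
lemma posSemidef_srmMatrix_mul_conjTranspose (hd : d ≠ 0) (hG : Vᴴ * V = circ d a l) :
    (srmMatrix V * Vᴴ).PosSemidef := by
  rw [srmMatrix_eq hd hG]
  exact (posSemidef_circ hd (by positivity) (by positivity)).mul_mul_conjTranspose_same V

lemma srmMatrix_mul_conjTranspose_mul (hd : d ≠ 0) (hG : Vᴴ * V = circ d a l) (ha : 0 ≤ a)
    (hl : 0 < l) : srmMatrix V * Vᴴ * srmMatrix V = V := by
  have h : Vᴴ * srmMatrix V = circ d (√a) (√l) := by
    rw [← conjTranspose_inj, conjTranspose_mul, conjTranspose_conjTranspose,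
      conjTranspose_srmMatrix_mul hd hG, circ_conjTranspose]
  rw [Matrix.mul_assoc, h, srmMatrix_eq hd hG, Matrix.mul_assoc, circ_mul hd,
    inv_mul_cancel₀ (Real.sqrt_pos.mpr hl).ne']
  conv_rhs => rw [← Matrix.mul_one V, ← circ_one_one]
  refine mul_circ_congr hd hG fun h0 => ?_
  exact inv_mul_cancel₀ (Real.sqrt_pos.mpr (lt_of_le_of_ne ha h0.symm)).ne'

/-- The diagonal entry of the square root of the Gram matrix. -/
noncomputable def sqrtDiag (d : ℕ) (a l : ℝ) : ℝ := √a + (√l - √a) / d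

lemma sqrtDiag_pos (hd : d ≠ 0) (hl : 0 < l) : 0 < sqrtDiag d a l := by
  have h1 : (1 : ℝ) ≤ d := by exact_mod_cast Nat.one_le_iff_ne_zero.mpr hd
  have h2 : sqrtDiag d a l = (√a * (d - 1) + √l) / d := by
    rw [sqrtDiag]; field_simp; ring
  rw [h2]
  have h3 := Real.sqrt_pos.mpr hl
  have h4 : 0 ≤ √a * ((d : ℝ) - 1) := mul_nonneg (Real.sqrt_nonneg a) (by linarith)
  positivity

lemma star_srmMatrix_col_dotProduct (hd : d ≠ 0) (hG : Vᴴ * V = circ d a l) (x : Fin d) :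
    star ((srmMatrix V).col x) ⬝ᵥ V.col x = sqrtDiag d a l := by
  have := congr_fun (congr_fun (conjTranspose_srmMatrix_mul hd hG) x) x
  rwa [circ_apply_self] at this

/-- Cauchy-Schwarz for `S = WVᴴ` at the measurement vector `w_x`: here `S w_x = V_x` and `⟨w_x, S
w_x⟩ = s`. -/
lemma posSemidef_sqrtDiag_smul_sub (hd : d ≠ 0) (hG : Vᴴ * V = circ d a l) (ha : 0 ≤ a)
    (hl : 0 < l) (x : Fin d) :
    ((sqrtDiag d a l : ℂ) • (srmMatrix V * Vᴴ) - proj (V.col x)).PosSemidef := by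
  have h : (srmMatrix V * Vᴴ) *ᵥ (srmMatrix V).col x = V.col x := by
    conv_rhs => rw [← srmMatrix_mul_conjTranspose_mul hd hG ha hl]
    rfl
  have h2 := posSemidef_smul_sub_proj_mulVec (posSemidef_srmMatrix_mul_conjTranspose hd hG)
    ((srmMatrix V).col x) (sqrtDiag_pos hd hl (a := a))
    (by rw [h, star_srmMatrix_col_dotProduct hd hG])
  rwa [h] at h2

lemma trace_srmMatrix_mul (hd : d ≠ 0) (hG : Vᴴ * V = circ d a l) :
    (srmMatrix V * Vᴴ).trace = ((d * sqrtDiag d a l : ℝ) : ℂ) := by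
  have h : (srmMatrix V * Vᴴ).trace = star ((srmMatrix V)ᴴ * V).trace := by
    rw [← trace_conjTranspose, conjTranspose_mul, conjTranspose_conjTranspose, trace_mul_comm]
  rw [h, conjTranspose_srmMatrix_mul hd hG]
  simp only [trace, diag_apply, circ_apply_self, Finset.sum_const, Finset.card_univ,
    Fintype.card_fin, nsmul_eq_mul, RCLike.star_def, map_mul, Complex.conj_natCast,
    Complex.conj_ofReal, sqrtDiag]
  push_cast
  rfl

end SquareRoot

/-! ### Inner products of Eve's conditional states. -/

lemma rhoAB_apply (d : ℕ) (β₀ β₁ : ℝ) (p q : Fin d × Fin d) :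
    rhoAB d β₀ β₁ p q = (((if p.1 = p.2 ∧ q.1 = q.2 then (β₀ - β₁) / d else 0) +
      if p = q then β₁ / d else 0 : ℝ) : ℂ) := by
  have hs : √(d : ℝ) * √(d : ℝ) = d := Real.mul_self_sqrt (Nat.cast_nonneg d)
  simp only [rhoAB, proj, maxEntangled, Matrix.add_apply, Matrix.smul_apply, vecMulVec_apply,
    Pi.star_apply, Matrix.one_apply, smul_eq_mul]
  by_cases h1 : p.1 = p.2 <;> by_cases h2 : q.1 = q.2 <;> by_cases h3 : p = q <;>
    simp only [h1, h2, h3, if_true, if_false, and_self, and_true, and_false, RCLike.star_def,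
      Complex.conj_ofReal, map_zero] <;> norm_cast <;>
    simp only [mul_zero, zero_mul, mul_one, add_zero, zero_add] <;>
    first
    | rw [div_mul_div_comm, hs]; ring
    | simp

/-- The squared norm of `(⟨x| ⊗ ⟨y| ⊗ 𝟙) |ψ⟩`. -/
noncomputable def weight (d : ℕ) (β₀ β₁ : ℝ) (x y : Fin d) : ℝ :=
  if x = y then β₀ / d else β₁ / d

section Purification

variable {d : ℕ} {β₀ β₁ : ℝ} {e : Type*} [Fintype e] [DecidableEq e]
  {ψ : (Fin d × Fin d) × e → ℂ}

/-- All inner products are read off `rhoAB`, so the choice of purification plays no role. -/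
lemma star_dotProduct_of_isPurification (hψ : IsPurification ψ (rhoAB d β₀ β₁))
    (p q : Fin d × Fin d) :
    star (fun k => ψ (p, k)) ⬝ᵥ (fun k => ψ (q, k)) = rhoAB d β₀ β₁ q p := by
  rw [← hψ]
  simp [partialTraceRight, proj, vecMulVec_apply, dotProduct, mul_comm]

lemma star_dotProduct_self_of_isPurification (hψ : IsPurification ψ (rhoAB d β₀ β₁))
    (x y : Fin d) :
    star (fun k => ψ ((x, y), k)) ⬝ᵥ (fun k => ψ ((x, y), k)) = weight d β₀ β₁ x y := by
  rw [star_dotProduct_of_isPurification hψ, rhoAB_apply]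
  by_cases h : x = y
  · simp only [h, weight, if_true, and_self]
    congr 1; ring
  · simp [h, weight]

lemma ancilla_eq (hψ : IsPurification ψ (rhoAB d β₀ β₁)) (x y : Fin d) :
    ancilla ψ x y = (((√(weight d β₀ β₁ x y))⁻¹ : ℝ) : ℂ) • fun k => ψ ((x, y), k) := by
  rw [ancilla, normalize, star_dotProduct_self_of_isPurification hψ, Complex.ofReal_re]

lemma star_ancilla_dotProduct (hψ : IsPurification ψ (rhoAB d β₀ β₁)) (x y : Fin d)
    (q : Fin d × Fin d) :
    star (ancilla ψ x y) ⬝ᵥ (fun k => ψ (q, k)) =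
      (((√(weight d β₀ β₁ x y))⁻¹ : ℝ) : ℂ) * rhoAB d β₀ β₁ q (x, y) := by
  rw [ancilla_eq hψ, star_smul, smul_dotProduct, star_dotProduct_of_isPurification hψ,
    RCLike.star_def, Complex.conj_ofReal, smul_eq_mul]

lemma star_ancilla_dotProduct_ancilla (hψ : IsPurification ψ (rhoAB d β₀ β₁))
    (x y x' y' : Fin d) :
    star (ancilla ψ x y) ⬝ᵥ ancilla ψ x' y' =
      (((√(weight d β₀ β₁ x' y'))⁻¹ : ℝ) : ℂ) * ((((√(weight d β₀ β₁ x y))⁻¹ : ℝ) : ℂ) *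
        rhoAB d β₀ β₁ (x', y') (x, y)) := by
  rw [ancilla_eq hψ x' y', dotProduct_smul, star_ancilla_dotProduct hψ, smul_eq_mul]

lemma weight_nonneg (hβ₀ : 0 ≤ β₀) (hβ₁ : 0 ≤ β₁) (x y : Fin d) : 0 ≤ weight d β₀ β₁ x y := by
  rw [weight]
  split_ifs <;> positivity

/-- Distinct ancillas are orthogonal, unless both of them are diagonal. -/
lemma star_ancilla_dotProduct_of_ne (hψ : IsPurification ψ (rhoAB d β₀ β₁))
    {x y : Fin d} {q : Fin d × Fin d} (h : (x, y) ≠ q) (h' : ¬ (x = y ∧ q.1 = q.2)) :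
    star (ancilla ψ x y) ⬝ᵥ (fun k => ψ (q, k)) = 0 := by
  have h'' : ¬ (q.1 = q.2 ∧ x = y) := fun hh => h' hh.symm
  rw [star_ancilla_dotProduct hψ, rhoAB_apply]
  simp only [h'', h.symm, if_false, add_zero, Complex.ofReal_zero, mul_zero]

lemma star_ancilla_dotProduct_ancilla_of_ne (hψ : IsPurification ψ (rhoAB d β₀ β₁))
    {x y x' y' : Fin d} (h : (x, y) ≠ (x', y')) (h' : ¬ (x = y ∧ x' = y')) :
    star (ancilla ψ x y) ⬝ᵥ ancilla ψ x' y' = 0 := by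
  rw [ancilla_eq hψ x' y', dotProduct_smul, star_ancilla_dotProduct_of_ne hψ h h', smul_zero]

lemma star_ancilla_dotProduct_same (hψ : IsPurification ψ (rhoAB d β₀ β₁)) (x y : Fin d) :
    star (ancilla ψ x y) ⬝ᵥ (fun k => ψ ((x, y), k)) = (√(weight d β₀ β₁ x y) : ℝ) := by
  rw [ancilla_eq hψ, star_smul, smul_dotProduct, star_dotProduct_self_of_isPurification hψ,
    RCLike.star_def, Complex.conj_ofReal, smul_eq_mul, ← Complex.ofReal_mul, inv_sqrt_mul_self]

lemma star_ancilla_dotProduct_self (hψ : IsPurification ψ (rhoAB d β₀ β₁)) {x y : Fin d}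
    (h : 0 < weight d β₀ β₁ x y) : star (ancilla ψ x y) ⬝ᵥ ancilla ψ x y = 1 := by
  nth_rewrite 2 [ancilla_eq hψ]
  rw [dotProduct_smul, star_ancilla_dotProduct_same hψ, smul_eq_mul, ← Complex.ofReal_mul,
    inv_mul_cancel₀ (Real.sqrt_pos.mpr h).ne', Complex.ofReal_one]

lemma smul_ancilla (hψ : IsPurification ψ (rhoAB d β₀ β₁)) {x y : Fin d}
    (h : 0 < weight d β₀ β₁ x y) :
    ((√(weight d β₀ β₁ x y) : ℝ) : ℂ) • ancilla ψ x y = fun k => ψ ((x, y), k) := by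
  rw [ancilla_eq hψ, smul_smul, ← Complex.ofReal_mul, mul_inv_cancel₀ (Real.sqrt_pos.mpr h).ne',
    Complex.ofReal_one, one_smul]

lemma weight_self_pos (hd : d ≠ 0) (hβ₀ : 0 < β₀) (x : Fin d) : 0 < weight d β₀ β₁ x x := by
  have : 0 < (d : ℝ) := by positivity
  rw [weight, if_pos rfl]
  positivity

lemma star_ancilla_diag_dotProduct (hd : d ≠ 0) (hβ₀ : 0 < β₀)
    (hψ : IsPurification ψ (rhoAB d β₀ β₁)) (x z : Fin d) :
    star (ancilla ψ x x) ⬝ᵥ ancilla ψ z z =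
      if x = z then 1 else ((1 - β₁ / β₀ : ℝ) : ℂ) := by
  by_cases h : x = z
  · rw [if_pos h, h, star_ancilla_dotProduct_self hψ (weight_self_pos hd hβ₀ z)]
  · have hd' : 0 < (d : ℝ) := by positivity
    have hs : (√(β₀ / d))⁻¹ * ((√(β₀ / d))⁻¹ * ((β₀ - β₁) / d)) = 1 - β₁ / β₀ := by
      rw [← mul_assoc, ← mul_inv, Real.mul_self_sqrt (by positivity)]
      field_simp
    have h' : ¬ ((z, z) = (x, x)) := fun hh => h (Prod.ext_iff.mp hh).1.symm
    rw [if_neg h, star_ancilla_dotProduct_ancilla hψ, rhoAB_apply]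
    simp only [weight, if_true, and_self, h', if_false, add_zero]
    exact_mod_cast hs

/-! ### The pyramid states and Eve's measurement. -/

/-- The matrix whose columns are the pyramid states. -/
noncomputable def pyramidMatrix (ψ : (Fin d × Fin d) × e → ℂ) : Matrix e (Fin d) ℂ :=
  fun k x => ancilla ψ x x k

lemma gram_pyramidMatrix (hd : d ≠ 0) (hβ₀ : 0 < β₀) (hψ : IsPurification ψ (rhoAB d β₀ β₁)) :
    (pyramidMatrix ψ)ᴴ * pyramidMatrix ψ =
      circ d (β₁ / β₀) (β₁ / β₀ + d * (1 - β₁ / β₀)) := by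
  ext x z
  have h : ((pyramidMatrix ψ)ᴴ * pyramidMatrix ψ) x z =
      star (ancilla ψ x x) ⬝ᵥ ancilla ψ z z := rfl
  have hd' : (d : ℝ) ≠ 0 := by exact_mod_cast hd
  rw [h, star_ancilla_diag_dotProduct hd hβ₀ hψ, circ]
  split_ifs
  · rw [← Complex.ofReal_one]
    congr 1
    field_simp
    ring
  · congr 1
    field_simp
    ring

lemma sum_pyramid (hd : d ≠ 0) (ψ : (Fin d × Fin d) × e → ℂ) :
    (d : ℂ) • ∑ z, pyramid ψ z = pyramidMatrix ψ * (pyramidMatrix ψ)ᴴ := by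
  have hd' : (d : ℂ) ≠ 0 := by exact_mod_cast hd
  simp only [pyramid]
  rw [← sum_proj_col, ← Finset.smul_sum, smul_smul, mul_one_div_cancel hd', one_smul]
  rfl

lemma srmVector_eq (hd : d ≠ 0) (ψ : (Fin d × Fin d) × e → ℂ) (x : Fin d) :
    srmVector ψ x = (srmMatrix (pyramidMatrix ψ)).col x := by
  rw [srmVector, sum_pyramid hd]
  rfl

lemma eveBlock_eq (ψ : (Fin d × Fin d) × e → ℂ) (x : Fin d) :
    eveBlock ψ x = ∑ y, proj fun k => ψ ((x, y), k) := by
  ext k l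
  simp [eveBlock, proj, vecMulVec_apply, Matrix.sum_apply]

lemma posSemidef_eveBlock (ψ : (Fin d × Fin d) × e → ℂ) (x : Fin d) :
    (eveBlock ψ x).PosSemidef := by
  rw [eveBlock_eq]
  exact posSemidef_sum _ fun y _ => posSemidef_proj _

lemma posSemidef_pyramid (ψ : (Fin d × Fin d) × e → ℂ) (x : Fin d) :
    (pyramid ψ x).PosSemidef := by
  have h := posSemidef_real_smul (posSemidef_proj (ancilla ψ x x))
    (t := 1 / d) (by positivity)
  rw [pyramid]
  push_cast at h
  exact h

lemma eveBlock_eq_add (hd : d ≠ 0) (hβ₀ : 0 < β₀) (hψ : IsPurification ψ (rhoAB d β₀ β₁))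
    (x : Fin d) :
    eveBlock ψ x = ((β₀ / d : ℝ) : ℂ) • proj (ancilla ψ x x) +
      ∑ y with y ≠ x, proj fun k => ψ ((x, y), k) := by
  have h : ((β₀ / d : ℝ) : ℂ) • proj (ancilla ψ x x) = proj fun k => ψ ((x, x), k) := by
    rw [← smul_ancilla hψ (weight_self_pos hd hβ₀ x), proj_smul, RCLike.star_def,
      Complex.conj_ofReal, ← Complex.ofReal_mul,
      Real.mul_self_sqrt (weight_self_pos hd hβ₀ x).le, weight, if_pos rfl]
  rw [h, eveBlock_eq, Finset.filter_ne',
    ← Finset.add_sum_erase _ _ (Finset.mem_univ x)]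

/-- The matrix whose columns are the states `|E_xy⟩` with `x ≠ y`. -/
noncomputable def offDiagMatrix (ψ : (Fin d × Fin d) × e → ℂ) : Matrix e (Fin d × Fin d) ℂ :=
  fun k p => if p.1 = p.2 then 0 else ancilla ψ p.1 p.2 k

lemma sum_srmElement (hd : d ≠ 0) (ψ : (Fin d × Fin d) × e → ℂ) :
    ∑ x, srmElement ψ x = srmMatrix (pyramidMatrix ψ) * (srmMatrix (pyramidMatrix ψ))ᴴ +
      offDiagMatrix ψ * (offDiagMatrix ψ)ᴴ := by
  rw [← sum_proj_col, ← sum_proj_col, Fintype.sum_prod_type, ← Finset.sum_add_distrib]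
  refine Finset.sum_congr rfl fun x _ => ?_
  rw [srmElement, srmVector_eq hd, Finset.sum_filter]
  congr 1
  refine Finset.sum_congr rfl fun y _ => ?_
  by_cases h : y = x
  · have : (offDiagMatrix ψ).col (x, y) = 0 := by
      ext k; simp [offDiagMatrix, h]
    rw [this, if_neg (not_not.mpr h), proj, zero_vecMulVec]
  · have : (offDiagMatrix ψ).col (x, y) = ancilla ψ x y := by
      ext k; simp [offDiagMatrix, Ne.symm h]
    rw [this, if_pos h]

lemma conjTranspose_pyramidMatrix_mul_offDiagMatrix (hψ : IsPurification ψ (rhoAB d β₀ β₁)) :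
    (pyramidMatrix ψ)ᴴ * offDiagMatrix ψ = 0 := by
  ext z p
  by_cases h : p.1 = p.2
  · simp [mul_apply, offDiagMatrix, h]
  · have h1 : ((pyramidMatrix ψ)ᴴ * offDiagMatrix ψ) z p =
        star (ancilla ψ z z) ⬝ᵥ ancilla ψ p.1 p.2 := by
      simp [mul_apply, offDiagMatrix, h, dotProduct, pyramidMatrix]
    rw [h1, star_ancilla_dotProduct_ancilla_of_ne hψ _ (fun hh => h hh.2), Matrix.zero_apply]
    intro hh
    have := Prod.ext_iff.mp hh
    exact h (this.1.symm.trans this.2)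

/-- The columns are pairwise orthogonal, each a unit vector or zero, so the matrix is a partial
isometry. -/
lemma offDiagMatrix_mul_mul (hβ₀ : 0 ≤ β₀) (hβ₁ : 0 ≤ β₁)
    (hψ : IsPurification ψ (rhoAB d β₀ β₁)) :
    offDiagMatrix ψ * ((offDiagMatrix ψ)ᴴ * offDiagMatrix ψ) = offDiagMatrix ψ := by
  ext k q
  by_cases hq : q.1 = q.2
  · simp [mul_apply, offDiagMatrix, hq]
  have hne : ∀ p, p ≠ q → ((offDiagMatrix ψ)ᴴ * offDiagMatrix ψ) p q = 0 := by
    intro p hp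
    by_cases hp' : p.1 = p.2
    · simp [mul_apply, offDiagMatrix, hp']
    · have h1 : ((offDiagMatrix ψ)ᴴ * offDiagMatrix ψ) p q =
          star (ancilla ψ p.1 p.2) ⬝ᵥ ancilla ψ q.1 q.2 := by
        simp [mul_apply, offDiagMatrix, hp', hq, dotProduct]
      rw [h1, star_ancilla_dotProduct_ancilla_of_ne hψ hp (fun hh => hq hh.2)]
  have h1 : ((offDiagMatrix ψ)ᴴ * offDiagMatrix ψ) q q =
      star (ancilla ψ q.1 q.2) ⬝ᵥ ancilla ψ q.1 q.2 := by
    simp [mul_apply, offDiagMatrix, hq, dotProduct]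
  rw [mul_apply, Finset.sum_eq_single q (fun p _ hp => by rw [hne p hp, mul_zero]) (by simp), h1]
  -- At weight `0` the normalization returns the zero vector.
  rcases (weight_nonneg hβ₀ hβ₁ q.1 q.2).eq_or_lt with h0 | h0
  · simp [offDiagMatrix, hq, ancilla_eq hψ, ← h0]
  · rw [star_ancilla_dotProduct_self hψ h0, mul_one]

lemma posSemidef_srmElement (ψ : (Fin d × Fin d) × e → ℂ) (x : Fin d) :
    (srmElement ψ x).PosSemidef :=
  (posSemidef_proj _).add (posSemidef_sum _ fun _ _ => posSemidef_proj _)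

/-- The sum is `YYᴴ + FFᴴ`, two projections with orthogonal ranges: `Y` is `V` times a matrix and
`VᴴF = 0`. -/
lemma posSemidef_one_sub_sum_srmElement (hd : d ≠ 0) (hβ₀ : 0 < β₀) (hβ₁ : 0 ≤ β₁)
    (hl : 0 < β₁ / β₀ + d * (1 - β₁ / β₀)) (hψ : IsPurification ψ (rhoAB d β₀ β₁)) :
    (1 - ∑ x, srmElement ψ x).PosSemidef := by
  have hG := gram_pyramidMatrix hd hβ₀ hψ
  have ha : 0 ≤ β₁ / β₀ := by positivity
  have h0 : (srmMatrix (pyramidMatrix ψ))ᴴ * offDiagMatrix ψ = 0 := by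
    rw [srmMatrix_eq hd hG, conjTranspose_mul, Matrix.mul_assoc,
      conjTranspose_pyramidMatrix_mul_offDiagMatrix hψ, Matrix.mul_zero]
  have h0' : (offDiagMatrix ψ)ᴴ * srmMatrix (pyramidMatrix ψ) = 0 := by
    rw [← conjTranspose_inj, conjTranspose_mul, conjTranspose_conjTranspose, h0,
      conjTranspose_zero]
  rw [sum_srmElement hd]
  set Y := srmMatrix (pyramidMatrix ψ)
  set F := offDiagMatrix ψ
  refine posSemidef_one_sub_of_sq
    ((isHermitian_mul_conjTranspose_self Y).add (isHermitian_mul_conjTranspose_self F)) ?_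
  have h1 : Y * Yᴴ * (F * Fᴴ) = 0 := by
    rw [Matrix.mul_assoc, ← Matrix.mul_assoc Yᴴ, h0, Matrix.zero_mul, Matrix.mul_zero]
  have h2 : F * Fᴴ * (Y * Yᴴ) = 0 := by
    rw [Matrix.mul_assoc, ← Matrix.mul_assoc Fᴴ, h0', Matrix.zero_mul, Matrix.mul_zero]
  have h3 : F * Fᴴ * (F * Fᴴ) = F * Fᴴ := by
    rw [← Matrix.mul_assoc, Matrix.mul_assoc F Fᴴ F, offDiagMatrix_mul_mul hβ₀.le hβ₁ hψ]
  rw [Matrix.add_mul, Matrix.mul_add, Matrix.mul_add, srmMatrix_mul_mul_self hd hG ha hl, h1, h2,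
    h3, add_zero, zero_add]

/-- The vectors of the measurement for the guess `x`. -/
noncomputable def srmFamily (ψ : (Fin d × Fin d) × e → ℂ) (x y : Fin d) : e → ℂ :=
  if y = x then srmVector ψ x else ancilla ψ x y

lemma srmElement_eq_sum (ψ : (Fin d × Fin d) × e → ℂ) (x : Fin d) :
    srmElement ψ x = ∑ y, proj (srmFamily ψ x y) := by
  rw [srmElement, Finset.filter_ne', ← Finset.add_sum_erase _ _ (Finset.mem_univ x)]
  congr 1
  · simp [srmFamily]
  · refine Finset.sum_congr rfl fun y hy => ?_
    rw [srmFamily, if_neg (Finset.ne_of_mem_erase hy)]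

/-- Orthogonality collapses the double sum in `tr (Mₓ ω x)` to its diagonal. -/
lemma normSq_star_srmFamily_dotProduct (hd : d ≠ 0) (hβ₀ : 0 < β₀) (hβ₁ : 0 ≤ β₁)
    (hψ : IsPurification ψ (rhoAB d β₀ β₁)) (x y y' : Fin d) :
    Complex.normSq (star (srmFamily ψ x y) ⬝ᵥ fun k => ψ ((x, y'), k)) =
      if y = y' then
        if y = x then β₀ / d * sqrtDiag d (β₁ / β₀) (β₁ / β₀ + d * (1 - β₁ / β₀)) ^ 2
        else β₁ / d
      else 0 := by
  have hG := gram_pyramidMatrix hd hβ₀ hψ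
  have hw := weight_nonneg hβ₀.le hβ₁ (d := d)
  by_cases hyx : y = x
  · subst hyx
    rw [srmFamily, if_pos rfl, srmVector_eq hd]
    by_cases h : y = y'
    · subst h
      have h1 := star_srmMatrix_col_dotProduct hd hG y
      have h2 : (pyramidMatrix ψ).col y = ancilla ψ y y := rfl
      rw [← smul_ancilla hψ (weight_self_pos hd hβ₀ y), dotProduct_smul, ← h2, h1, smul_eq_mul,
        ← Complex.ofReal_mul, Complex.normSq_ofReal, if_pos rfl, if_pos rfl, mul_mul_mul_comm,
        Real.mul_self_sqrt (hw y y), weight, if_pos rfl, sq]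
    · have h1 : (pyramidMatrix ψ)ᴴ *ᵥ (fun k => ψ ((y, y'), k)) = 0 := by
        ext z
        have h2 : ((pyramidMatrix ψ)ᴴ *ᵥ fun k => ψ ((y, y'), k)) z =
          star (ancilla ψ z z) ⬝ᵥ fun k => ψ ((y, y'), k) := rfl
        rw [h2, star_ancilla_dotProduct_of_ne hψ _ (fun hh => h hh.2), Pi.zero_apply]
        intro hh
        have := Prod.ext_iff.mp hh
        exact h (this.1.symm.trans this.2)
      have h3 : ((srmMatrix (pyramidMatrix ψ))ᴴ *ᵥ fun k => ψ ((y, y'), k)) = 0 := by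
        rw [srmMatrix_eq hd hG, conjTranspose_mul, ← mulVec_mulVec, h1, mulVec_zero]
      have h4 : (star ((srmMatrix (pyramidMatrix ψ)).col y) ⬝ᵥ fun k => ψ ((y, y'), k)) = 0 :=
        congr_fun h3 y
      rw [h4, if_neg h, map_zero]
  · rw [srmFamily, if_neg hyx]
    by_cases h : y = y'
    · subst h
      rw [star_ancilla_dotProduct_same hψ, Complex.normSq_ofReal, Real.mul_self_sqrt (hw x y),
        if_pos rfl, if_neg hyx, weight, if_neg (Ne.symm hyx)]
    · rw [star_ancilla_dotProduct_of_ne hψ (fun hh => h (Prod.ext_iff.mp hh).2)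
        (fun hh => hyx hh.1.symm), if_neg h, map_zero]

lemma guessValue_srmElement (hd : d ≠ 0) (hβ₀ : 0 < β₀) (hβ₁ : 0 ≤ β₁)
    (hψ : IsPurification ψ (rhoAB d β₀ β₁)) :
    guessValue (srmElement ψ) (eveBlock ψ) =
      β₀ * sqrtDiag d (β₁ / β₀) (β₁ / β₀ + d * (1 - β₁ / β₀)) ^ 2 + (d - 1) * β₁ := by
  have hd' : (d : ℝ) ≠ 0 := by exact_mod_cast hd
  have h1 : 1 ≤ d := Nat.one_le_iff_ne_zero.mpr hd
  rw [guessValue_eq_sum]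
  have h : ∀ x, (srmElement ψ x * eveBlock ψ x).trace.re =
      β₀ / d * sqrtDiag d (β₁ / β₀) (β₁ / β₀ + d * (1 - β₁ / β₀)) ^ 2 +
        (d - 1) * (β₁ / d) := by
    intro x
    rw [srmElement_eq_sum, eveBlock_eq, Finset.sum_mul_sum, trace_sum, Complex.re_sum]
    simp only [trace_sum, Complex.re_sum, trace_proj_mul_proj, Complex.ofReal_re,
      normSq_star_srmFamily_dotProduct hd hβ₀ hβ₁ hψ, Finset.sum_ite_eq, Finset.mem_univ, if_true]
    rw [← Finset.add_sum_erase _ _ (Finset.mem_univ x), if_pos rfl,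
      Finset.sum_congr rfl fun y hy => if_neg (Finset.ne_of_mem_erase hy), Finset.sum_const,
      Finset.card_erase_of_mem (Finset.mem_univ x), Finset.card_univ, Fintype.card_fin,
      nsmul_eq_mul, Nat.cast_sub h1, Nat.cast_one]
  simp only [h, Finset.sum_const, Finset.card_univ, Fintype.card_fin, nsmul_eq_mul]
  field_simp

/-! ### The dual solution and optimality. -/

/-- The dual solution for the guessing problem of Alice's dit. -/
noncomputable def dualOperator (β₀ β₁ : ℝ) (ψ : (Fin d × Fin d) × e → ℂ) : Matrix e e ℂ :=
  ((β₀ / d : ℝ) : ℂ) • ((sqrtDiag d (β₁ / β₀) (β₁ / β₀ + d * (1 - β₁ / β₀)) : ℂ) •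
    (srmMatrix (pyramidMatrix ψ) * (pyramidMatrix ψ)ᴴ)) +
    ∑ x, ∑ y with y ≠ x, proj fun k => ψ ((x, y), k)

/-- Subtracting `ω x` leaves `β₀/d` times the pyramid slack, plus the off-diagonal projectors of the
other `x'`. -/
lemma posSemidef_dualOperator_sub (hd : d ≠ 0) (hβ₀ : 0 < β₀) (hβ₁ : 0 ≤ β₁)
    (hl : 0 < β₁ / β₀ + d * (1 - β₁ / β₀)) (hψ : IsPurification ψ (rhoAB d β₀ β₁)) (x : Fin d) :
    (dualOperator β₀ β₁ ψ - eveBlock ψ x).PosSemidef := by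
  have hG := gram_pyramidMatrix hd hβ₀ hψ
  have h1 := posSemidef_real_smul
    (posSemidef_sqrtDiag_smul_sub hd hG (by positivity) hl x) (t := β₀ / d) (by positivity)
  have h2 : (∑ x' ∈ Finset.univ.erase x, ∑ y with y ≠ x',
      proj fun k => ψ ((x', y), k)).PosSemidef :=
    posSemidef_sum _ fun _ _ => posSemidef_sum _ fun _ _ => posSemidef_proj _
  convert h1.add h2 using 1
  have h3 : (pyramidMatrix ψ).col x = ancilla ψ x x := rfl
  rw [dualOperator, eveBlock_eq_add hd hβ₀ hψ, ← Finset.add_sum_erase _ _ (Finset.mem_univ x),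
    smul_sub, h3]
  abel

lemma trace_proj (v : e → ℂ) : (proj v).trace = star v ⬝ᵥ v := by
  rw [proj, trace_vecMulVec, dotProduct_comm]

lemma trace_dualOperator (hd : d ≠ 0) (hβ₀ : 0 < β₀) (hψ : IsPurification ψ (rhoAB d β₀ β₁)) :
    (dualOperator β₀ β₁ ψ).trace.re =
      β₀ * sqrtDiag d (β₁ / β₀) (β₁ / β₀ + d * (1 - β₁ / β₀)) ^ 2 + (d - 1) * β₁ := by
  have hd' : (d : ℝ) ≠ 0 := by exact_mod_cast hd
  have h1 : 1 ≤ d := Nat.one_le_iff_ne_zero.mpr hd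
  have h : ∀ x, ∑ y with y ≠ x, weight d β₀ β₁ x y = (d - 1) * (β₁ / d) := by
    intro x
    rw [Finset.filter_ne', Finset.sum_congr rfl fun y hy =>
      (show weight d β₀ β₁ x y = β₁ / d from if_neg (Finset.ne_of_mem_erase hy).symm),
      Finset.sum_const,
      Finset.card_erase_of_mem (Finset.mem_univ x), Finset.card_univ, Fintype.card_fin,
      nsmul_eq_mul, Nat.cast_sub h1, Nat.cast_one]
  rw [dualOperator, trace_add, trace_smul, trace_smul,
    trace_srmMatrix_mul hd (gram_pyramidMatrix hd hβ₀ hψ), trace_sum]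
  simp only [trace_sum, trace_proj, star_dotProduct_self_of_isPurification hψ, smul_eq_mul,
    ← Complex.ofReal_mul, ← Complex.ofReal_sum, h, Complex.add_re, Complex.ofReal_re,
    Finset.sum_const, Finset.card_univ, Fintype.card_fin]
  rw [nsmul_eq_mul, ← Complex.ofReal_natCast, ← Complex.ofReal_mul, Complex.ofReal_re]
  field_simp

/-- The optimal discrimination of the pyramid states. -/
lemma isGreatest_guessValues_pyramid (hd : d ≠ 0) (hβ₀ : 0 < β₀) (hβ₁ : 0 ≤ β₁)
    (hl : 0 < β₁ / β₀ + d * (1 - β₁ / β₀)) (hψ : IsPurification ψ (rhoAB d β₀ β₁)) :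
    IsGreatest (guessValues (pyramid ψ))
      (sqrtDiag d (β₁ / β₀) (β₁ / β₀ + d * (1 - β₁ / β₀)) ^ 2) := by
  have hd' : (d : ℝ) ≠ 0 := by exact_mod_cast hd
  have : Nonempty (Fin d) := ⟨⟨0, Nat.pos_of_ne_zero hd⟩⟩
  have hG := gram_pyramidMatrix hd hβ₀ hψ
  have ha : 0 ≤ β₁ / β₀ := by positivity
  set s := sqrtDiag d (β₁ / β₀) (β₁ / β₀ + d * (1 - β₁ / β₀)) with hs
  set V := pyramidMatrix ψ with hV
  have htr : ((((1 / d : ℝ) : ℂ) • ((s : ℂ) • (srmMatrix V * Vᴴ))).trace).re = s ^ 2 := by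
    rw [trace_smul, trace_smul, trace_srmMatrix_mul hd hG, smul_eq_mul, smul_eq_mul,
      ← Complex.ofReal_mul, ← Complex.ofReal_mul, Complex.ofReal_re, ← hs]
    field_simp
  rw [← htr]
  refine isGreatest_guessValues (M := fun x => proj ((srmMatrix V).col x))
    (fun x => posSemidef_proj _) ?_ (posSemidef_pyramid ψ) (fun x => ?_) ?_
  · rw [sum_proj_col]
    exact posSemidef_one_sub_of_sq (isHermitian_mul_conjTranspose_self _)
      (srmMatrix_mul_mul_self hd hG ha hl)
  · have h := posSemidef_real_smul
      (posSemidef_sqrtDiag_smul_sub hd hG ha hl x) (t := 1 / d) (by positivity)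
    rw [smul_sub] at h
    convert h using 2
    rw [pyramid]
    push_cast
    rfl
  · rw [htr, guessValue_eq_sum]
    have h : ∀ x, (proj ((srmMatrix V).col x) * pyramid ψ x).trace.re = 1 / d * s ^ 2 := by
      intro x
      have h1 := star_srmMatrix_col_dotProduct hd hG x
      have h2 : V.col x = ancilla ψ x x := rfl
      have h3 : (1 / d : ℂ) = ((1 / d : ℝ) : ℂ) := by push_cast; rfl
      rw [pyramid, ← h2, Matrix.mul_smul, trace_smul, trace_proj_mul_proj, h1,
        Complex.normSq_ofReal, smul_eq_mul, h3, ← Complex.ofReal_mul, Complex.ofReal_re, ← hs, sq]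
    simp only [h, Finset.sum_const, Finset.card_univ, Fintype.card_fin, nsmul_eq_mul]
    field_simp

lemma isGreatest_guessValues_eveBlock (hd : d ≠ 0) (hβ₀ : 0 < β₀) (hβ₁ : 0 ≤ β₁)
    (hl : 0 < β₁ / β₀ + d * (1 - β₁ / β₀)) (hψ : IsPurification ψ (rhoAB d β₀ β₁)) :
    IsGreatest (guessValues (eveBlock ψ)) (dualOperator β₀ β₁ ψ).trace.re := by
  have : Nonempty (Fin d) := ⟨⟨0, Nat.pos_of_ne_zero hd⟩⟩
  refine isGreatest_guessValues (posSemidef_srmElement ψ)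
    (posSemidef_one_sub_sum_srmElement hd hβ₀ hβ₁ hl hψ) (posSemidef_eveBlock ψ)
    (posSemidef_dualOperator_sub hd hβ₀ hβ₁ hl hψ) ?_
  rw [guessValue_srmElement hd hβ₀ hβ₁ hψ, trace_dualOperator hd hβ₀ hψ]

end Purification

/-! ### The closed form and the final assembly. -/

/-- The closed form of the success probability for the pyramid states. -/
lemma sqrtDiag_sq_eq_bracket_div {d : ℕ} (hd : 2 ≤ d) {β₀ β₁ : ℝ}
    (hsum : β₀ + (d - 1) * β₁ = 1) (hβ₁ : 0 ≤ β₁) (hβ₀ : 0 < β₀)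
    (hl : 0 < β₁ / β₀ + d * (1 - β₁ / β₀)) :
    sqrtDiag d (β₁ / β₀) (β₁ / β₀ + d * (1 - β₁ / β₀)) ^ 2 = bracket d (1 - β₀) / d := by
  have hd2 : (2 : ℝ) ≤ d := by exact_mod_cast hd
  have hd1 : (d : ℝ) - 1 ≠ 0 := by linarith
  have hd0 : (d : ℝ) ≠ 0 := by linarith
  have ha : 0 ≤ β₁ / β₀ := by positivity
  set a := β₁ / β₀ with ha_def
  set l := a + d * (1 - a) with hl_def
  have hβ : β₁ = a * β₀ := by rw [ha_def]; field_simp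
  have hA : √a ^ 2 = a := Real.sq_sqrt ha
  have hL : √l ^ 2 = l := Real.sq_sqrt hl.le
  have hsum' : β₀ * (1 + (d - 1) * a) = 1 := by
    linear_combination hsum - (d - 1) * hβ
  have hden : 1 + ((d : ℝ) - 1) * a ≠ 0 := right_ne_zero_of_mul_eq_one hsum'
  have hβ₀' : β₀ = (1 + (d - 1) * a)⁻¹ := eq_inv_of_mul_eq_one_left hsum'
  -- Since `Q/β₀ = (d-1)a` and `1/β₀ = 1 + (d-1)a`, the radicand is `a l / d²`: the cross term of
  -- `s²`.
  have hrad : (d * (1 - β₀) - (d + 1) * (1 - β₀) ^ 2) / ((d - 1) * d ^ 2 * (1 - (1 - β₀)) ^ 2) =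
      (√a * √l / d) ^ 2 := by
    rw [div_pow, mul_pow, hA, hL, hl_def, hβ₀']
    field_simp
    ring
  rw [bracket, hrad, Real.sqrt_sq (by positivity), sqrtDiag]
  have hlhs : (√a + (√l - √a) / d) ^ 2 =
      ((d - 1) ^ 2 * √a ^ 2 + √l ^ 2 + 2 * (d - 1) * (√a * √l)) / d ^ 2 := by
    field_simp
    ring
  have hq : (1 - β₀) / (1 - β₀ - 1) = -((d - 1) * a) := by
    rw [hβ₀']; field_simp; ring
  have hfrac : ((d : ℝ) - 2) * (1 - β₀) / (d * (1 - β₀ - 1)) =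
      (d - 2) / d * -((d - 1) * a) := by
    rw [← hq, div_mul_div_comm]
  rw [hlhs, hA, hL, hfrac, hl_def]
  field_simp
  ring

end QKD


theorem mainTheorem1 (d : ℕ) (hd : 2 ≤ d) (β₀ β₁ Q : ℝ)
    (hsum : β₀ + (d - 1) * β₁ = 1) (hβ₁ : 0 ≤ β₁) (hβ₁d : β₁ < 1 / d) (hβ₀d : 1 / d < β₀)
    (hβ₀ : β₀ ≤ 1) (hQ : Q = 1 - β₀)
    {e : Type*} [Fintype e] [DecidableEq e] (ψ : (Fin d × Fin d) × e → ℂ)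
    (hψ : QKD.IsPurification ψ (QKD.rhoAB d β₀ β₁)) :
    -- the states `|E_xx⟩` are pyramid states
    (∀ x z, star (QKD.ancilla ψ x x) ⬝ᵥ QKD.ancilla ψ z z =
      if x = z then 1 else ((1 - β₁ / β₀ : ℝ) : ℂ)) ∧
    -- the square-root measurement identifies each of them with probability `bracket d Q / d`,
    -- and no measurement does better
    (∀ x, Complex.normSq (star (QKD.srmVector ψ x) ⬝ᵥ QKD.ancilla ψ x x) =
      QKD.bracket d Q / d) ∧
    IsGreatest (QKD.guessValues (QKD.pyramid ψ)) (QKD.bracket d Q / d) ∧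
    -- the optimal guessing probability for Alice's dit
    IsGreatest (QKD.guessValues (QKD.eveBlock ψ)) (QKD.pGuess (QKD.eveBlock ψ)) ∧
    QKD.pGuess (QKD.eveBlock ψ) = Q + (1 - Q) / d * QKD.bracket d Q ∧
    -- it is reached by the square-root measurement together with the projections on the
    -- `|E_xy⟩` with `x ≠ y`, which is a measurement up to an inconclusive outcome
    (∀ x, (QKD.srmElement ψ x).PosSemidef) ∧
    (1 - ∑ x, QKD.srmElement ψ x).PosSemidef ∧
    QKD.guessValue (QKD.srmElement ψ) (QKD.eveBlock ψ) = QKD.pGuess (QKD.eveBlock ψ) ∧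
    -- the conditional min-entropy
    IsLUB (QKD.minEntropyValues (QKD.cqState (QKD.eveBlock ψ)))
      (QKD.minEntropy (QKD.cqState (QKD.eveBlock ψ))) ∧
    QKD.minEntropy (QKD.cqState (QKD.eveBlock ψ)) =
      -Real.logb 2 (Q + (1 - Q) / d * QKD.bracket d Q) ∧
    -- the case of qubits
    (d = 2 → QKD.pGuess (QKD.eveBlock ψ) = 1 / 2 * (1 + √(Q * (2 - 3 * Q)) + Q)) := by
  have hd0 : d ≠ 0 := by omega
  have hd2 : (2 : ℝ) ≤ d := by exact_mod_cast hd
  have hdpos : (0 : ℝ) < d := by linarith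
  have hβ₀pos : 0 < β₀ := lt_trans (by positivity) hβ₀d
  have hlt : β₁ / β₀ < 1 := (div_lt_one hβ₀pos).mpr (hβ₁d.trans hβ₀d)
  have ha : 0 ≤ β₁ / β₀ := by positivity
  -- The strict inequality `β₁ < β₀` keeps the eigenvalue on constant vectors positive.
  have hl : 0 < β₁ / β₀ + d * (1 - β₁ / β₀) :=
    add_pos_of_nonneg_of_pos ha (mul_pos hdpos (by linarith))
  have hbr := QKD.sqrtDiag_sq_eq_bracket_div hd hsum hβ₁ hβ₀pos hl
  rw [← hQ] at hbr
  have hval : β₀ * QKD.sqrtDiag d (β₁ / β₀) (β₁ / β₀ + d * (1 - β₁ / β₀)) ^ 2 + (d - 1) * β₁ =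
      Q + (1 - Q) / d * QKD.bracket d Q := by
    have h1 : (d - 1) * β₁ = Q := by rw [hQ]; linarith
    have h2 : β₀ = 1 - Q := by rw [hQ]; ring
    rw [hbr, h1, h2]
    ring
  have htr := QKD.trace_dualOperator hd0 hβ₀pos hψ
  have hG := QKD.isGreatest_guessValues_eveBlock hd0 hβ₀pos hβ₁ hl hψ
  have hp : QKD.pGuess (QKD.eveBlock ψ) = (QKD.dualOperator β₀ β₁ ψ).trace.re := hG.csSup_eq
  have hpos : 0 < (QKD.dualOperator β₀ β₁ ψ).trace.re := by
    rw [htr]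
    have := QKD.sqrtDiag_pos hd0 hl (a := β₁ / β₀)
    exact add_pos_of_pos_of_nonneg (by positivity) (mul_nonneg (by linarith) hβ₁)
  have hH := QKD.isGreatest_minEntropyValues (QKD.posSemidef_eveBlock ψ)
    (QKD.posSemidef_dualOperator_sub hd0 hβ₀pos hβ₁ hl hψ) hpos hG
  have hm : QKD.minEntropy (QKD.cqState (QKD.eveBlock ψ)) =
    -Real.logb 2 (QKD.dualOperator β₀ β₁ ψ).trace.re := hH.csSup_eq
  refine ⟨QKD.star_ancilla_diag_dotProduct hd0 hβ₀pos hψ, fun x => ?_, ?_, ?_, ?_,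
    QKD.posSemidef_srmElement ψ, QKD.posSemidef_one_sub_sum_srmElement hd0 hβ₀pos hβ₁ hl hψ, ?_,
    ?_, ?_, ?_⟩
  · rw [← hbr, QKD.srmVector_eq hd0, sq, ← Complex.normSq_ofReal]
    exact congrArg _ (QKD.star_srmMatrix_col_dotProduct hd0
      (QKD.gram_pyramidMatrix hd0 hβ₀pos hψ) x)
  · rw [← hbr]
    exact QKD.isGreatest_guessValues_pyramid hd0 hβ₀pos hβ₁ hl hψ
  · rw [hp]
    exact hG
  · rw [hp, htr, hval]
  · rw [QKD.guessValue_srmElement hd0 hβ₀pos hβ₁ hψ, hp, htr]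
  · rw [hm]
    exact hH.isLUB
  · rw [hm, htr, hval]
  · rintro rfl
    have hQ1 : 0 < 1 - Q := by linarith
    have hrad : ((2 : ℕ) * Q - ((2 : ℕ) + 1) * Q ^ 2) /
        (((2 : ℕ) - 1) * ((2 : ℕ) : ℝ) ^ 2 * (1 - Q) ^ 2) =
        Q * (2 - 3 * Q) / (2 * (1 - Q)) ^ 2 := by
      push_cast
      congr 1 <;> ring
    rw [hp, htr, hval, QKD.bracket, hrad, Real.sqrt_div' _ (by positivity),
      Real.sqrt_sq (by positivity)]
    push_cast
    have hQ2 : 1 - Q ≠ 0 := hQ1.ne'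
    field_simp
    ring
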